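/- Theorem (Pure DP Lower Bound for Covariance-Aware Gaussian Mean Estimation). There is an absolute constant $c>0$ with the following property. Let $d\ge 1$ and $n\ge 0$ be integers, let $\alpha>0$, $L\ge 1$, $R>8\alpha/\sqrt L$, $\varepsilon\in(0,1)$ and $\beta\in(0,7/8]$. Let $M$ be a randomized algorithm which maps data sets $X\in(\mathbb R^d)^n$ to $\mathbb R^d$ and is $\varepsilon$-differentially private, i.e. $\Pr[M(X)\in S]\le e^{\varepsilon}\,\Pr[M(X')\in S]$ for all $X,X'\in(\mathbb R^d)^n$ at Hamming distance $1$ (differing in exactly one of the $n$ points) and all measurable $S\subseteq\mathbb R^d$. Suppose that for every $\mu\in\mathbb R^d$ with $\|\mu\|_2\le R$ and every symmetric matrix $\Sigma\in\mathbb R^{d\times d}$ with $\Sigma\succeq\frac1L I$, given independent samples $X_1,\dots,X_n\sim\mathcal N(\mu,\Sigma)$, the algorithm $M$ outputs, with probability at least $1-\beta$ over the samples and its internal randomness, some $\hat\mu$ with $\|\Sigma^{-1/2}(\mu-\hat\mu)\|_2\le\alpha$. Then $$ n\;\ge\; c\left(\frac{d+\log(1/\beta)}{\alpha^2}+\frac{d+\log(1/\beta)}{\alpha\varepsilon}+\frac{d\log(R\sqrt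 L/\alpha)+\log(1/\beta)}{\varepsilon}\right). $$ -/

import Mathlib

open MeasureTheory ProbabilityTheory
open scoped MatrixOrder

noncomputable section

open Classical in
/-- A randomized mechanism `M` (a Markov kernel) taking data sets of `n` records in `α` to outputs
in `β` is (pure) `ε`-differentially private: for all data sets `X`, `X'` at Hamming distance one
and every event `S`, `P[M(X) ∈ S] ≤ e^ε * P[M(X') ∈ S]`. -/
def IsPureDP {n : ℕ} {α β : Type*} [MeasurableSpace α] [MeasurableSpace β]
    (M : Kernel (Fin n → α) β) (ε : ℝ) : Prop :=
  ∀ X X' : Fin n → α, hammingDist X X' = 1 →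
    ∀ S : Set β, MeasurableSet S → M X S ≤ ENNReal.ofReal (Real.exp ε) * M X' S

/-- The law of the output of the mechanism `M` when it is run, with fresh randomness, on `n`
independent samples from `P`. -/
def outputLaw {n : ℕ} {α β : Type*} [MeasurableSpace α] [MeasurableSpace β]
    (M : Kernel (Fin n → α) β) (P : Measure α) : Measure β :=
  (Measure.pi (fun _ : Fin n => P)).bind M

/-- The Mahalanobis norm `‖Σ^{-1/2} v‖₂`, for a positive definite matrix `S` in the role of `Σ`. -/
def mahalanobisNorm {d : ℕ} (S : Matrix (Fin d) (Fin d) ℝ) (v : EuclideanSpace ℝ (Fin d)) : ℝ :=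
  ‖Matrix.toEuclideanCLM (𝕜 := ℝ) (CFC.sqrt S)⁻¹ v‖

/-- With probability at least `1 - β`, on `n` independent samples from any Gaussian `N(μ, Σ)` on
`ℝ^d` with `‖μ‖₂ ≤ R` and `Σ ⪰ (1/L) I`, the mechanism `M` outputs an estimate of `μ` of
Mahalanobis error at most `α`. -/
def EstimatesGaussianMean {d n : ℕ}
    (M : Kernel (Fin n → EuclideanSpace ℝ (Fin d)) (EuclideanSpace ℝ (Fin d)))
    (R L α β : ℝ) : Prop :=
  ∀ (μ : EuclideanSpace ℝ (Fin d)) (S : Matrix (Fin d) (Fin d) ℝ),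
    ‖μ‖ ≤ R → (S - (1 / L) • (1 : Matrix (Fin d) (Fin d) ℝ)).PosSemidef →
      ENNReal.ofReal (1 - β) ≤
        outputLaw M (multivariateGaussian μ S) {μ' | mahalanobisNorm S (μ - μ') ≤ α}

end

open scoped ENNReal RealInnerProductSpace

/-! Only the covariance `I/L` is needed: there, accuracy `α` means landing in the Euclidean ball of
radius `r = α/√L` about `μ`. Let `P μ` be the output law for mean `μ`. Every bound comes from a
comparison `P μ (S) ^ a ≤ K * P μ' (S)` with `a = 20/19`, valid for all means in a ball of radius `ρ
> 8 r`.

Such a comparison forces `log K` to be at least of order `d log(ρ/r) + log(1/β)`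
(`mul_log_add_log_le_log`). Each ball about a possible mean has probability at least `8^(-a)/K`
under the single law `P 0`, and averaging over the centre gives the dimension term by volume. Two
disjoint balls give the `log(1/β)` term. Nine disjoint balls give `log K` a positive absolute lower
bound, which absorbs the additive constants left by the other two.

Three values of `K` give the three terms. Replacing all `n` records one at a time costs `e^(nε)` for
any two means, used with `ρ = R`. For means within `18 r`, each replacement costs only `e^(O(αε))`:
a private mechanism varies by a factor of at most `e^ε` in each record, and Gaussians shifted by
`O(α)` standard deviations are within `O(α)` in total variation (`lintegral_add_stdGaussian_le`).
Without privacy, Hölder's inequality against the Gaussian density ratio costs `e^(O(α^2))` per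
sample (`rpow_lintegral_add_stdGaussian_le`); this is why `a` must exceed 1. -/

/-! ### Product measures and tensorization -/

theorem lintegral_pi_fin_zero {α : Type*} [MeasurableSpace α] (μ : Fin 0 → Measure α)
    {f : (Fin 0 → α) → ℝ≥0∞} (hf : Measurable f) :
    ∫⁻ x, f x ∂Measure.pi μ = f default := by
  rw [Measure.pi_of_empty μ default, lintegral_dirac' _ hf]

theorem lintegral_pi_fin_succ {α : Type*} [MeasurableSpace α] {n : ℕ}
    (μ : Fin (n + 1) → Measure α) [∀ i, SigmaFinite (μ i)]
    {f : (Fin (n + 1) → α) → ℝ≥0∞} (hf : Measurable f) :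
    ∫⁻ x, f x ∂Measure.pi μ =
      ∫⁻ y, ∫⁻ a, f (Fin.cons a y) ∂μ 0 ∂Measure.pi (fun i : Fin n => μ i.succ) := by
  have h := ((measurePreserving_piFinSuccAbove μ 0).symm).lintegral_comp hf
  rw [← h, lintegral_prod_symm]
  · simp [MeasurableEquiv.piFinSuccAbove_symm_apply, Fin.insertNthEquiv]
  · exact (hf.comp (MeasurableEquiv.measurable _)).aemeasurable

@[fun_prop]
theorem measurable_fin_cons_prod {α : Type*} [MeasurableSpace α] {n : ℕ} :
    Measurable (fun p : (Fin n → α) × α => (Fin.cons p.2 p.1 : Fin (n + 1) → α)) := by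
  refine measurable_pi_lambda _ fun i => ?_
  refine Fin.cases ?_ (fun j => ?_) i
  · simpa using measurable_snd
  · simpa using! (measurable_pi_apply j).comp measurable_fst

theorem measurable_lintegral_fin_cons {α : Type*} [MeasurableSpace α] {n : ℕ} (μ : Measure α)
    [SFinite μ] {f : (Fin (n + 1) → α) → ℝ≥0∞} (hf : Measurable f) :
    Measurable fun y : Fin n → α => ∫⁻ a, f (Fin.cons a y) ∂μ :=
  Measurable.lintegral_prod_right' (f := fun p : (Fin n → α) × α => f (Fin.cons p.2 p.1))
    (hf.comp measurable_fin_cons_prod)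

/-- If each `P i` has density `h i` with respect to `Q i`, then the product of the `P i` has the
product density. -/
theorem lintegral_pi_of_density {α : Type*} [MeasurableSpace α] {n : ℕ}
    (P Q : Fin n → Measure α) [∀ i, SigmaFinite (P i)] [∀ i, SigmaFinite (Q i)]
    (h : Fin n → α → ℝ≥0∞) (hh : ∀ i, Measurable (h i))
    (hPQ : ∀ i (g : α → ℝ≥0∞), Measurable g → ∫⁻ x, g x ∂P i = ∫⁻ x, g x * h i x ∂Q i)
    {f : (Fin n → α) → ℝ≥0∞} (hf : Measurable f) :
    ∫⁻ x, f x ∂Measure.pi P = ∫⁻ x, f x * ∏ i, h i (x i) ∂Measure.pi Q := by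
  induction n with
  | zero => rw [lintegral_pi_fin_zero _ hf, lintegral_pi_fin_zero _ (by fun_prop)]; simp
  | succ n ih =>
    rw [lintegral_pi_fin_succ P hf, lintegral_pi_fin_succ Q (by fun_prop),
      ih _ _ (fun i => h i.succ) (fun i => hh _) (fun i => hPQ _)
        (measurable_lintegral_fin_cons _ hf)]
    refine lintegral_congr fun y => ?_
    have hm : Measurable fun a => f (Fin.cons a y) :=
      hf.comp (measurable_fin_cons_prod.comp (measurable_const.prodMk measurable_id))
    have hm0 : Measurable fun a => f (Fin.cons a y) * h 0 a := hm.mul (hh 0)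
    rw [hPQ 0 _ hm, ← lintegral_mul_const _ hm0]
    refine lintegral_congr fun a => ?_
    rw [Fin.prod_univ_succ]
    simp [mul_assoc]

theorem hammingDist_fin_cons_left {α : Type*} [DecidableEq α] {n : ℕ} {a b : α} (hab : a ≠ b)
    (y : Fin n → α) : hammingDist (Fin.cons a y : Fin (n + 1) → α) (Fin.cons b y) = 1 := by
  simp [hammingDist, Finset.card_filter, Fin.sum_univ_succ, hab]

theorem hammingDist_fin_cons_right {α : Type*} [DecidableEq α] {n : ℕ} (a : α)
    (y z : Fin n → α) :
    hammingDist (Fin.cons a y : Fin (n + 1) → α) (Fin.cons a z) = hammingDist y z := by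
  simp [hammingDist, Finset.card_filter, Fin.sum_univ_succ]

open Classical in
/-- Replacing the samples one at a time: a comparison of the means under `P` and `Q` of the
functions of one variable which vary by a factor of at most `e` tensorizes to functions which vary
by a factor of at most `e` when one variable is changed. -/
theorem lintegral_pi_le_of_hammingDist {α : Type*} [MeasurableSpace α] (P Q : Measure α)
    [IsProbabilityMeasure P] [IsProbabilityMeasure Q] {e K : ℝ≥0∞} (he : 1 ≤ e)
    (hPQ : ∀ g : α → ℝ≥0∞, Measurable g → (∀ x, g x ≤ 1) → (∀ x y, g x ≤ e * g y) →
      ∫⁻ x, g x ∂P ≤ K * ∫⁻ x, g x ∂Q)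
    {n : ℕ} {f : (Fin n → α) → ℝ≥0∞} (hf : Measurable f) (hf1 : ∀ x, f x ≤ 1)
    (hfe : ∀ x y, hammingDist x y = 1 → f x ≤ e * f y) :
    ∫⁻ x, f x ∂Measure.pi (fun _ => P) ≤ K ^ n * ∫⁻ x, f x ∂Measure.pi (fun _ => Q) := by
  induction n with
  | zero => simp [lintegral_pi_fin_zero _ hf]
  | succ n ih =>
    rw [lintegral_pi_fin_succ _ hf, lintegral_pi_fin_succ _ hf]
    have hm : ∀ y : Fin n → α, Measurable fun a => f (Fin.cons a y) := fun y =>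
      hf.comp (measurable_fin_cons_prod.comp (measurable_const.prodMk measurable_id))
    calc ∫⁻ y, ∫⁻ a, f (Fin.cons a y) ∂P ∂Measure.pi (fun _ => P)
        ≤ ∫⁻ y, K * ∫⁻ a, f (Fin.cons a y) ∂Q ∂Measure.pi (fun _ => P) := by
          refine lintegral_mono fun y => hPQ _ (hm y) (fun _ => hf1 _) fun a b => ?_
          -- If the records coincide the Hamming distance is 0, and `1 ≤ e` is used instead of the
          -- hypothesis on neighbours.
          by_cases hab : a = b
          · subst hab
            exact le_mul_of_one_le_left' he
          · exact hfe _ _ (hammingDist_fin_cons_left hab y)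
      _ = K * ∫⁻ y, ∫⁻ a, f (Fin.cons a y) ∂Q ∂Measure.pi (fun _ => P) :=
          lintegral_const_mul _ (measurable_lintegral_fin_cons _ hf)
      _ ≤ K * (K ^ n * ∫⁻ y, ∫⁻ a, f (Fin.cons a y) ∂Q ∂Measure.pi (fun _ => Q)) := by
          gcongr
          -- Averaging out the first record preserves both the bound by 1 and the bounded variation
          -- between neighbours.
          refine ih (measurable_lintegral_fin_cons _ hf) (fun y => ?_) fun y z hyz => ?_
          · exact (lintegral_mono fun a => hf1 _).trans (by simp)
          · rw [← lintegral_const_mul _ (hm z)]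
            exact lintegral_mono fun a => hfe _ _ (by rw [hammingDist_fin_cons_right, hyz])
      _ = K ^ (n + 1) * ∫⁻ y, ∫⁻ a, f (Fin.cons a y) ∂Q ∂Measure.pi (fun _ => Q) := by
          rw [pow_succ, mul_comm (K ^ n) K, mul_assoc]

/-- A reverse Hölder comparison of `P` and `Q` tensorizes. -/
theorem rpow_lintegral_pi_le {α : Type*} [MeasurableSpace α] (P Q : Measure α)
    [SigmaFinite P] [SigmaFinite Q] {q : ℝ} {K : ℝ≥0∞}
    (hPQ : ∀ g : α → ℝ≥0∞, Measurable g → (∫⁻ x, g x ∂P) ^ q ≤ K * ∫⁻ x, g x ^ q ∂Q)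
    {n : ℕ} {f : (Fin n → α) → ℝ≥0∞} (hf : Measurable f) :
    (∫⁻ x, f x ∂Measure.pi (fun _ => P)) ^ q ≤
      K ^ n * ∫⁻ x, f x ^ q ∂Measure.pi (fun _ => Q) := by
  induction n with
  | zero => simp [lintegral_pi_fin_zero _ hf, lintegral_pi_fin_zero _ (hf.pow_const q)]
  | succ n ih =>
    rw [lintegral_pi_fin_succ _ hf, lintegral_pi_fin_succ _ (hf.pow_const q)]
    have hm : ∀ y : Fin n → α, Measurable fun a => f (Fin.cons a y) := fun y =>
      hf.comp (measurable_fin_cons_prod.comp (measurable_const.prodMk measurable_id))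
    refine (ih (measurable_lintegral_fin_cons _ hf)).trans ?_
    calc K ^ n * ∫⁻ y, (∫⁻ a, f (Fin.cons a y) ∂P) ^ q ∂Measure.pi (fun _ => Q)
        ≤ K ^ n * ∫⁻ y, K * ∫⁻ a, f (Fin.cons a y) ^ q ∂Q ∂Measure.pi (fun _ => Q) := by
          gcongr with y
          exact hPQ _ (hm y)
      _ = _ := by
          rw [lintegral_const_mul _ (measurable_lintegral_fin_cons _ (hf.pow_const q)), pow_succ,
            mul_assoc]

/-! ### Shifts of the standard Gaussian -/

theorem lintegral_gaussianReal_one_eq (m : ℝ) {g : ℝ → ℝ≥0∞} (hg : Measurable g) :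
    ∫⁻ x, g x ∂gaussianReal m 1 =
      ∫⁻ x, g x * ENNReal.ofReal (Real.exp (m * x - m ^ 2 / 2)) ∂gaussianReal 0 1 := by
  have hm : Measurable fun x => ENNReal.ofReal (Real.exp (m * x - m ^ 2 / 2)) := by fun_prop
  rw [gaussianReal_of_var_ne_zero _ one_ne_zero, gaussianReal_of_var_ne_zero _ one_ne_zero,
    lintegral_withDensity_eq_lintegral_mul _ (measurable_gaussianPDF _ _) hg,
    lintegral_withDensity_eq_lintegral_mul _ (measurable_gaussianPDF _ _)
      (show Measurable fun x => g x * _ from hg.mul hm)]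
  refine lintegral_congr fun x => ?_
  have h : gaussianPDF m 1 x =
      gaussianPDF 0 1 x * ENNReal.ofReal (Real.exp (m * x - m ^ 2 / 2)) := by
    rw [gaussianPDF, gaussianPDF, ← ENNReal.ofReal_mul (gaussianPDFReal_nonneg _ _ _)]
    congr 1
    simp only [gaussianPDFReal, NNReal.coe_one, mul_assoc, ← Real.exp_add]
    congr 2
    ring
  simp only [Pi.mul_apply, h]
  ring

section GaussianShift

variable {d : ℕ}

/-- The density at `x` of the standard Gaussian measure shifted by `v`, with respect to the
standard Gaussian measure. -/
noncomputable def gaussianShiftDensity (v x : EuclideanSpace ℝ (Fin d)) : ℝ :=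
  Real.exp (⟪v, x⟫ - ‖v‖ ^ 2 / 2)

@[fun_prop]
theorem measurable_gaussianShiftDensity (v : EuclideanSpace ℝ (Fin d)) :
    Measurable (gaussianShiftDensity v) := by
  unfold gaussianShiftDensity
  fun_prop

theorem gaussianShiftDensity_pos (v x : EuclideanSpace ℝ (Fin d)) :
    0 < gaussianShiftDensity v x :=
  Real.exp_pos _

theorem lintegral_add_stdGaussian (v : EuclideanSpace ℝ (Fin d))
    {g : EuclideanSpace ℝ (Fin d) → ℝ≥0∞} (hg : Measurable g) :
    ∫⁻ x, g (x + v) ∂stdGaussian (EuclideanSpace ℝ (Fin d)) =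
      ∫⁻ x, g x * ENNReal.ofReal (gaussianShiftDensity v x)
        ∂stdGaussian (EuclideanSpace ℝ (Fin d)) := by
  have hg' : Measurable fun y : Fin d → ℝ => g (WithLp.toLp 2 y) := by fun_prop
  have hpi : (Measure.pi fun i : Fin d => gaussianReal (v i) 1) =
      (Measure.pi fun _ : Fin d => gaussianReal 0 1).map fun y i => y i + v i := by
    rw [Measure.pi_map_pi (μ := fun _ => gaussianReal 0 1)
      (f := fun i (t : ℝ) => t + v i) (fun i => by fun_prop)]
    simp [gaussianReal_map_add_const]
  rw [← map_pi_eq_stdGaussian, lintegral_map (by fun_prop) (by fun_prop),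
    lintegral_map (by fun_prop) (by fun_prop)]
  calc ∫⁻ y, g (WithLp.toLp 2 y + v) ∂Measure.pi (fun _ : Fin d => gaussianReal 0 1)
      = ∫⁻ y, g (WithLp.toLp 2 y) ∂Measure.pi fun i : Fin d => gaussianReal (v i) 1 := by
        rw [hpi, lintegral_map hg' (by fun_prop)]
        rfl
    _ = _ := by
        rw [lintegral_pi_of_density _ (fun _ => gaussianReal 0 1)
          (fun i x => ENNReal.ofReal (Real.exp (v i * x - v i ^ 2 / 2))) (fun i => by fun_prop)
          (fun i g hg => lintegral_gaussianReal_one_eq _ hg) hg']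
        refine lintegral_congr fun y => ?_
        rw [← ENNReal.ofReal_prod_of_nonneg fun i _ => (Real.exp_pos _).le, ← Real.exp_sum]
        congr 3
        rw [Finset.sum_sub_distrib, ← Finset.sum_div, EuclideanSpace.real_norm_sq_eq]
        simp [PiLp.inner_apply, mul_comm]

theorem lintegral_gaussianShiftDensity (v : EuclideanSpace ℝ (Fin d)) :
    ∫⁻ x, ENNReal.ofReal (gaussianShiftDensity v x)
      ∂stdGaussian (EuclideanSpace ℝ (Fin d)) = 1 := by
  simpa using (lintegral_add_stdGaussian v (g := fun _ => 1) measurable_const).symm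

theorem gaussianShiftDensity_rpow (v x : EuclideanSpace ℝ (Fin d)) (p : ℝ) :
    gaussianShiftDensity v x ^ p =
      Real.exp ((p ^ 2 - p) * ‖v‖ ^ 2 / 2) * gaussianShiftDensity (p • v) x := by
  rw [gaussianShiftDensity, gaussianShiftDensity, ← Real.exp_mul, ← Real.exp_add,
    real_inner_smul_left, norm_smul, mul_pow, Real.norm_eq_abs, sq_abs]
  congr 1
  ring

theorem lintegral_gaussianShiftDensity_rpow (v : EuclideanSpace ℝ (Fin d)) (p : ℝ) :
    ∫⁻ x, ENNReal.ofReal (gaussianShiftDensity v x ^ p) ∂stdGaussian (EuclideanSpace ℝ (Fin d)) =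
      ENNReal.ofReal (Real.exp ((p ^ 2 - p) * ‖v‖ ^ 2 / 2)) := by
  simp_rw [gaussianShiftDensity_rpow, ENNReal.ofReal_mul (Real.exp_pos _).le]
  rw [lintegral_const_mul _ (by fun_prop), lintegral_gaussianShiftDensity, mul_one]

/-- Hölder's inequality separates `g` from the shift density, whose `p`-th moment is explicit. After
raising to the power `q`, the exponent simplifies by `(p - 1) * q = p`. -/
theorem rpow_lintegral_add_stdGaussian_le (v : EuclideanSpace ℝ (Fin d)) {p q : ℝ}
    (hpq : p.HolderConjugate q)
    {g : EuclideanSpace ℝ (Fin d) → ℝ≥0∞} (hg : Measurable g) :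
    (∫⁻ x, g (x + v) ∂stdGaussian (EuclideanSpace ℝ (Fin d))) ^ q ≤
      ENNReal.ofReal (Real.exp (p * ‖v‖ ^ 2 / 2)) *
        ∫⁻ x, g x ^ q ∂stdGaussian (EuclideanSpace ℝ (Fin d)) := by
  rw [lintegral_add_stdGaussian v hg]
  have h := ENNReal.lintegral_mul_le_Lp_mul_Lq (stdGaussian (EuclideanSpace ℝ (Fin d)))
    hpq.symm hg.aemeasurable
    (g := fun x => ENNReal.ofReal (gaussianShiftDensity v x)) (by fun_prop)
  refine (ENNReal.rpow_le_rpow h hpq.symm.nonneg).trans_eq ?_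
  simp_rw [ENNReal.ofReal_rpow_of_pos (gaussianShiftDensity_pos _ _)]
  rw [lintegral_gaussianShiftDensity_rpow, ENNReal.mul_rpow_of_nonneg _ _ hpq.symm.nonneg,
    ← ENNReal.rpow_mul, one_div_mul_cancel hpq.symm.ne_zero, ENNReal.rpow_one, mul_comm,
    ENNReal.ofReal_rpow_of_pos (Real.exp_pos _), ENNReal.ofReal_rpow_of_pos (by positivity),
    ← Real.exp_mul, ← Real.exp_mul]
  congr 3
  have hp := hpq.ne_zero
  have : (p - 1) * q = p := hpq.sub_one_mul_conj
  field_simp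
  linear_combination ‖v‖ ^ 2 * this

theorem integrable_gaussianShiftDensity_rpow (v : EuclideanSpace ℝ (Fin d)) (p : ℝ) :
    Integrable (fun x => gaussianShiftDensity v x ^ p)
      (stdGaussian (EuclideanSpace ℝ (Fin d))) := by
  refine ⟨Measurable.aestronglyMeasurable (by fun_prop), ?_⟩
  rw [hasFiniteIntegral_iff_ofReal
    (ae_of_all _ fun x => Real.rpow_nonneg (gaussianShiftDensity_pos v x).le p),
    lintegral_gaussianShiftDensity_rpow]
  exact ENNReal.ofReal_lt_top

theorem integral_gaussianShiftDensity_rpow (v : EuclideanSpace ℝ (Fin d)) (p : ℝ) :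
    ∫ x, gaussianShiftDensity v x ^ p ∂stdGaussian (EuclideanSpace ℝ (Fin d)) =
      Real.exp ((p ^ 2 - p) * ‖v‖ ^ 2 / 2) := by
  rw [integral_eq_lintegral_of_nonneg_ae
    (ae_of_all _ fun x => Real.rpow_nonneg (gaussianShiftDensity_pos v x).le p)
    (Measurable.aestronglyMeasurable (by fun_prop)), lintegral_gaussianShiftDensity_rpow,
    ENNReal.toReal_ofReal (Real.exp_pos _).le]

theorem integrable_gaussianShiftDensity (v : EuclideanSpace ℝ (Fin d)) :
    Integrable (gaussianShiftDensity v) (stdGaussian (EuclideanSpace ℝ (Fin d))) := by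
  simpa using integrable_gaussianShiftDensity_rpow v 1

theorem integrable_gaussianShiftDensity_sq (v : EuclideanSpace ℝ (Fin d)) :
    Integrable (fun x => gaussianShiftDensity v x ^ 2)
      (stdGaussian (EuclideanSpace ℝ (Fin d))) := by
  simpa using integrable_gaussianShiftDensity_rpow v 2

theorem integral_gaussianShiftDensity (v : EuclideanSpace ℝ (Fin d)) :
    ∫ x, gaussianShiftDensity v x ∂stdGaussian (EuclideanSpace ℝ (Fin d)) = 1 := by
  simpa using integral_gaussianShiftDensity_rpow v 1

theorem integral_gaussianShiftDensity_sq (v : EuclideanSpace ℝ (Fin d)) :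
    ∫ x, gaussianShiftDensity v x ^ 2 ∂stdGaussian (EuclideanSpace ℝ (Fin d)) =
      Real.exp (‖v‖ ^ 2) := by
  have h := integral_gaussianShiftDensity_rpow v 2
  simp only [Real.rpow_ofNat] at h
  rw [h]
  congr 1
  ring

theorem integrable_abs_gaussianShiftDensity_sub_one (v : EuclideanSpace ℝ (Fin d)) :
    Integrable (fun x => |gaussianShiftDensity v x - 1|)
      (stdGaussian (EuclideanSpace ℝ (Fin d))) :=
  ((integrable_gaussianShiftDensity v).sub (integrable_const 1)).abs

theorem integral_abs_gaussianShiftDensity_sub_one_le {v : EuclideanSpace ℝ (Fin d)}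
    (hv : ‖v‖ ≤ 1) :
    ∫ x, |gaussianShiftDensity v x - 1| ∂stdGaussian (EuclideanSpace ℝ (Fin d)) ≤
      3 / 2 * ‖v‖ := by
  rcases (norm_nonneg v).eq_or_lt with h0 | h0
  · rw [eq_comm, norm_eq_zero] at h0
    simp [h0, gaussianShiftDensity]
  have hsub : Integrable (fun x => (gaussianShiftDensity v x - 1) ^ 2)
      (stdGaussian (EuclideanSpace ℝ (Fin d))) := by
    simp_rw [sub_sq]
    exact ((integrable_gaussianShiftDensity_sq v).sub
      (((integrable_gaussianShiftDensity v).const_mul 2).mul_const 1)).add (integrable_const _)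
  have hsq : ∫ x, (gaussianShiftDensity v x - 1) ^ 2
      ∂stdGaussian (EuclideanSpace ℝ (Fin d)) = Real.exp (‖v‖ ^ 2) - 1 := by
    have h1 : ∀ x, (gaussianShiftDensity v x - 1) ^ 2 =
        gaussianShiftDensity v x ^ 2 - 2 * gaussianShiftDensity v x + 1 := fun x => by ring
    simp_rw [h1]
    have h2 : Integrable (fun x => gaussianShiftDensity v x ^ 2 - 2 * gaussianShiftDensity v x)
        (stdGaussian (EuclideanSpace ℝ (Fin d))) :=
      (integrable_gaussianShiftDensity_sq v).sub ((integrable_gaussianShiftDensity v).const_mul 2)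
    rw [integral_add h2 (integrable_const _),
      integral_sub (integrable_gaussianShiftDensity_sq v)
      ((integrable_gaussianShiftDensity v).const_mul 2), integral_const_mul,
      integral_gaussianShiftDensity, integral_gaussianShiftDensity_sq]
    simp
    ring
  have hexp : Real.exp (‖v‖ ^ 2) ≤ 1 + 2 * ‖v‖ ^ 2 := by
    have h2 : ‖v‖ ^ 2 ≤ 1 := pow_le_one₀ h0.le hv
    have := Real.abs_exp_sub_one_sub_id_le (x := ‖v‖ ^ 2) (by rwa [abs_of_nonneg (sq_nonneg _)])
    have := (abs_le.mp this).2
    nlinarith [sq_nonneg ‖v‖]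
  -- AM-GM with weight `‖v‖` stands in for Cauchy–Schwarz: `|t| ≤ ‖v‖/2 + t^2/(2‖v‖)`.
  calc ∫ x, |gaussianShiftDensity v x - 1| ∂stdGaussian (EuclideanSpace ℝ (Fin d))
      ≤ ∫ x, (‖v‖ / 2 + (gaussianShiftDensity v x - 1) ^ 2 / (2 * ‖v‖))
          ∂stdGaussian (EuclideanSpace ℝ (Fin d)) := by
        refine integral_mono (integrable_abs_gaussianShiftDensity_sub_one v)
          ((integrable_const _).add (hsub.div_const _)) fun x => ?_
        have h3 := sq_nonneg (‖v‖ - |gaussianShiftDensity v x - 1|)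
        rw [sub_sq, sq_abs] at h3
        simp only
        field_simp
        linarith
    _ = ‖v‖ / 2 + (Real.exp (‖v‖ ^ 2) - 1) / (2 * ‖v‖) := by
        rw [integral_add (integrable_const _) (hsub.div_const _), integral_div,
          integral_div, hsq]
        simp
    _ ≤ ‖v‖ / 2 + 2 * ‖v‖ ^ 2 / (2 * ‖v‖) := by gcongr; linarith
    _ = 3 / 2 * ‖v‖ := by field_simp; ring

/-- With `A` the mean of `F`, all values of `F` lie between `e^(-ε) A` and `e^ε A`, an interval of
length at most `3εA`. Since the density minus 1 has mean zero, a constant may be subtracted from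
`F`, so the mean changes by at most `3εA * (3/2)‖v‖ ≤ 5ε‖v‖A`. -/
theorem integral_add_stdGaussian_le {v : EuclideanSpace ℝ (Fin d)} (hv : ‖v‖ ≤ 1) {ε : ℝ}
    (hε0 : 0 ≤ ε) (hε : ε ≤ 1) {F : EuclideanSpace ℝ (Fin d) → ℝ} (hF : Measurable F)
    (hF0 : ∀ x, 0 ≤ F x) (hFε : ∀ x y, F x ≤ Real.exp ε * F y) :
    ∫ x, F x * gaussianShiftDensity v x ∂stdGaussian (EuclideanSpace ℝ (Fin d)) ≤
      Real.exp (5 * ε * ‖v‖) * ∫ x, F x ∂stdGaussian (EuclideanSpace ℝ (Fin d)) := by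
  set γ := stdGaussian (EuclideanSpace ℝ (Fin d))
  set A := ∫ x, F x ∂γ
  have hbd : ∀ x, ‖F x‖ ≤ Real.exp ε * F 0 := fun x => by
    rw [Real.norm_of_nonneg (hF0 x)]; exact hFε x 0
  have hFi : Integrable F γ := Integrable.of_bound hF.aestronglyMeasurable _ (ae_of_all _ hbd)
  have hA0 : 0 ≤ A := integral_nonneg hF0
  have hup : ∀ x, F x ≤ Real.exp ε * A := fun x => by
    have := integral_mono (μ := γ) (integrable_const (F x)) (hFi.const_mul (Real.exp ε))
      fun y => hFε x y
    rwa [integral_const_mul, integral_const, probReal_univ, one_smul] at this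
  have hlow : ∀ y, Real.exp (-ε) * A ≤ F y := fun y => by
    have := integral_mono (μ := γ) hFi (integrable_const (Real.exp ε * F y)) fun x => hFε x y
    rw [integral_const, probReal_univ, one_smul] at this
    calc Real.exp (-ε) * A ≤ Real.exp (-ε) * (Real.exp ε * F y) := by gcongr
      _ = F y := by rw [← mul_assoc, ← Real.exp_add]; simp
  have hD : Real.exp ε - Real.exp (-ε) ≤ 3 * ε := by
    have := Real.abs_exp_sub_one_sub_id_le (x := ε) (by rwa [abs_of_nonneg hε0])
    have := (abs_le.mp this).2
    have := Real.add_one_le_exp (-ε)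
    nlinarith
  have hFρ : Integrable (fun x => F x * gaussianShiftDensity v x) γ :=
    (integrable_gaussianShiftDensity v).bdd_mul hF.aestronglyMeasurable (ae_of_all _ hbd)
  have hρ1 : Integrable (fun x => gaussianShiftDensity v x - 1) γ :=
    (integrable_gaussianShiftDensity v).sub (integrable_const 1)
  have hdiff : ∫ x, F x * gaussianShiftDensity v x ∂γ - A =
      ∫ x, (F x - Real.exp (-ε) * A) * (gaussianShiftDensity v x - 1) ∂γ := by
    have h1 : ∀ x, (F x - Real.exp (-ε) * A) * (gaussianShiftDensity v x - 1) =
        (F x * gaussianShiftDensity v x - F x) -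
          Real.exp (-ε) * A * (gaussianShiftDensity v x - 1) := fun x => by ring
    simp_rw [h1]
    have h2 : Integrable (fun x => F x * gaussianShiftDensity v x - F x) γ := hFρ.sub hFi
    rw [integral_sub h2 (hρ1.const_mul _),
      integral_sub hFρ hFi, integral_const_mul,
      integral_sub (integrable_gaussianShiftDensity v) (integrable_const 1),
      integral_gaussianShiftDensity]
    simp [A]
  have hle : ∫ x, (F x - Real.exp (-ε) * A) * (gaussianShiftDensity v x - 1) ∂γ ≤
      ∫ x, (Real.exp ε - Real.exp (-ε)) * A * |gaussianShiftDensity v x - 1| ∂γ := by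
    refine integral_mono
      (hρ1.bdd_mul (c := (Real.exp ε - Real.exp (-ε)) * A)
        (hF.sub_const _).aestronglyMeasurable (ae_of_all _ fun x => ?_))
      (hρ1.abs.const_mul _) fun x => ?_
    · rw [Real.norm_of_nonneg (sub_nonneg.mpr (hlow x)), sub_mul]
      exact sub_le_sub_right (hup x) _
    · calc (F x - Real.exp (-ε) * A) * (gaussianShiftDensity v x - 1)
          ≤ (F x - Real.exp (-ε) * A) * |gaussianShiftDensity v x - 1| :=
            mul_le_mul_of_nonneg_left (le_abs_self _) (sub_nonneg.mpr (hlow x))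
        _ ≤ (Real.exp ε - Real.exp (-ε)) * A * |gaussianShiftDensity v x - 1| := by
            rw [sub_mul (Real.exp ε)]
            gcongr
            exact hup x
  have hτ := integral_abs_gaussianShiftDensity_sub_one_le hv
  rw [integral_const_mul] at hle
  have h2 : (Real.exp ε - Real.exp (-ε)) * A *
      ∫ x, |gaussianShiftDensity v x - 1| ∂γ ≤ 3 * ε * A * (3 / 2 * ‖v‖) := by
    gcongr
  have h3 := Real.add_one_le_exp (5 * ε * ‖v‖)
  have h4 : 0 ≤ ε * ‖v‖ * A := by positivity
  nlinarith

/-- For functions which vary by a factor of at most `e ^ ε`, shifting a Gaussian by `v` changes the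
mean by a factor of only `e ^ O(ε ‖v‖)`. -/
theorem lintegral_add_stdGaussian_le (v : EuclideanSpace ℝ (Fin d)) {ε : ℝ}
    (hε0 : 0 ≤ ε) (hε : ε ≤ 1) {g : EuclideanSpace ℝ (Fin d) → ℝ≥0∞} (hg : Measurable g)
    (hg1 : ∀ x, g x ≤ 1) (hgε : ∀ x y, g x ≤ ENNReal.ofReal (Real.exp ε) * g y) :
    ∫⁻ x, g (x + v) ∂stdGaussian (EuclideanSpace ℝ (Fin d)) ≤
      ENNReal.ofReal (Real.exp (5 * ε * ‖v‖)) *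
        ∫⁻ x, g x ∂stdGaussian (EuclideanSpace ℝ (Fin d)) := by
  rcases le_total ‖v‖ 1 with hv | hv
  · have htop : ∀ x, g x ≠ ∞ := fun x => ((hg1 x).trans_lt ENNReal.one_lt_top).ne
    have hF := integral_add_stdGaussian_le hv hε0 hε hg.ennreal_toReal
      (fun x => ENNReal.toReal_nonneg) fun x y => by
        have := ENNReal.toReal_mono (ENNReal.mul_ne_top ENNReal.ofReal_ne_top (htop y)) (hgε x y)
        rwa [ENNReal.toReal_mul, ENNReal.toReal_ofReal (Real.exp_pos _).le] at this
    rw [lintegral_add_stdGaussian v hg]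
    rw [integral_eq_lintegral_of_nonneg_ae (ae_of_all _ fun x => ENNReal.toReal_nonneg)
      hg.ennreal_toReal.aestronglyMeasurable, integral_eq_lintegral_of_nonneg_ae
      (ae_of_all _ fun x => mul_nonneg ENNReal.toReal_nonneg (gaussianShiftDensity_pos v x).le)
      (Measurable.aestronglyMeasurable (by fun_prop))] at hF
    simp_rw [ENNReal.ofReal_mul ENNReal.toReal_nonneg, ENNReal.ofReal_toReal (htop _)] at hF
    have hfin1 : ∫⁻ x, g x * ENNReal.ofReal (gaussianShiftDensity v x)
        ∂stdGaussian (EuclideanSpace ℝ (Fin d)) ≠ ∞ := by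
      refine ((lintegral_mono fun x => mul_le_of_le_one_left' (hg1 x)).trans_lt ?_).ne
      rw [lintegral_gaussianShiftDensity]
      exact ENNReal.one_lt_top
    have hfin2 : ∫⁻ x, g x ∂stdGaussian (EuclideanSpace ℝ (Fin d)) ≠ ∞ :=
      ((lintegral_mono hg1).trans_lt (by simp)).ne
    rw [← ENNReal.ofReal_toReal hfin1, ← ENNReal.ofReal_toReal hfin2,
      ← ENNReal.ofReal_mul (Real.exp_pos _).le]
    exact ENNReal.ofReal_le_ofReal hF
  -- For `‖v‖ ≥ 1` the trivial factor `e^ε` is already at most `e^(5ε‖v‖)`.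
  · have h1 : ∀ x, g x ≤ ENNReal.ofReal (Real.exp ε) *
        ∫⁻ y, g y ∂stdGaussian (EuclideanSpace ℝ (Fin d)) := fun x => by
      rw [← lintegral_const_mul _ hg]
      simpa using lintegral_mono (μ := stdGaussian (EuclideanSpace ℝ (Fin d)))
        (f := fun _ => g x) fun y => hgε x y
    calc ∫⁻ x, g (x + v) ∂stdGaussian (EuclideanSpace ℝ (Fin d))
        ≤ ENNReal.ofReal (Real.exp ε) * ∫⁻ y, g y ∂stdGaussian (EuclideanSpace ℝ (Fin d)) :=
          (lintegral_mono fun x => h1 _).trans (by simp)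
      _ ≤ _ := by
          gcongr
          nlinarith

end GaussianShift

/-! ### Packing bounds for families of comparable laws -/

section Packing

variable {d : ℕ} {ρ r a b K : ℝ} {P : EuclideanSpace ℝ (Fin d) → Measure (EuclideanSpace ℝ (Fin d))}
  [∀ μ, IsProbabilityMeasure (P μ)]

open Metric in
/-- The average over the centre of the probability of a ball of radius `r` is bounded by the ratio
of volumes. -/
theorem lintegral_closedBall_measure_le (ν : Measure (EuclideanSpace ℝ (Fin d)))
    [IsProbabilityMeasure ν] (r : ℝ) (B : Set (EuclideanSpace ℝ (Fin d))) :
    ∫⁻ μ in B, ν (closedBall μ r) ≤ volume (closedBall (0 : EuclideanSpace ℝ (Fin d)) r) := by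
  have hm : Measurable fun p : EuclideanSpace ℝ (Fin d) × EuclideanSpace ℝ (Fin d) =>
      (closedBall p.1 r).indicator (fun _ => (1 : ℝ≥0∞)) p.2 := by
    have hs : MeasurableSet
        {p : EuclideanSpace ℝ (Fin d) × EuclideanSpace ℝ (Fin d) | dist p.2 p.1 ≤ r} :=
      measurableSet_le (by fun_prop) measurable_const
    exact (measurable_const (a := (1 : ℝ≥0∞))).indicator hs
  calc ∫⁻ μ in B, ν (closedBall μ r)
      ≤ ∫⁻ μ, ν (closedBall μ r) := setLIntegral_le_lintegral _ _
    _ = ∫⁻ μ, ∫⁻ y, (closedBall μ r).indicator (fun _ => 1) y ∂ν ∂volume := by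
        simp [measurableSet_closedBall]
    -- For a fixed output `y`, the centres whose ball contains `y` again form a ball of radius `r`.
    _ = ∫⁻ y, ∫⁻ μ, (closedBall μ r).indicator (fun _ => 1) y ∂volume ∂ν :=
        lintegral_lintegral_swap hm.aemeasurable
    _ = ∫⁻ y, volume (closedBall (0 : EuclideanSpace ℝ (Fin d)) r) ∂ν := by
        refine lintegral_congr fun y => ?_
        rw [← Measure.addHaar_closedBall_center volume y r,
          ← lintegral_indicator_one measurableSet_closedBall]
        refine lintegral_congr fun μ => ?_
        simp [Set.indicator, dist_comm]
    _ = _ := by simp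

-- A volume argument in place of an explicit packing: `P 0` gives every ball of radius `r` centred
-- in the `ρ`-ball mass at least `8^(-a)/K`, while the integral of this mass over the centre is at
-- most the volume of one `r`-ball.
open Metric in
theorem rpow_mul_div_pow_le (hr : 0 < r) (hρ : 0 < ρ) (ha : 0 ≤ a) (hK : 0 < K) (hb : b ≤ 7 / 8)
    (hP : ∀ μ μ' S, ‖μ‖ ≤ ρ → ‖μ'‖ ≤ ρ → MeasurableSet S →
      (P μ).real S ^ a ≤ K * (P μ').real S)
    (hacc : ∀ μ, ‖μ‖ ≤ ρ → 1 - b ≤ (P μ).real (closedBall μ r)) :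
    (1 / 8 : ℝ) ^ a * (ρ / r) ^ d ≤ K := by
  have hlow : ∀ μ ∈ closedBall (0 : EuclideanSpace ℝ (Fin d)) ρ,
      ENNReal.ofReal ((1 / 8 : ℝ) ^ a / K) ≤ P 0 (closedBall μ r) := fun μ hμ => by
    rw [mem_closedBall_zero_iff] at hμ
    have h1 := hP μ 0 (closedBall μ r) hμ (by simpa using hρ.le) measurableSet_closedBall
    have h2 : (1 / 8 : ℝ) ^ a ≤ (P μ).real (closedBall μ r) ^ a := by
      gcongr
      linarith [hacc μ hμ]
    refine ENNReal.ofReal_le_of_le_toReal ?_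
    rw [div_le_iff₀' hK]
    exact h2.trans h1
  have h1 : ENNReal.ofReal ((1 / 8 : ℝ) ^ a / K) *
      volume (closedBall (0 : EuclideanSpace ℝ (Fin d)) ρ) ≤
      volume (closedBall (0 : EuclideanSpace ℝ (Fin d)) r) := by
    rw [← setLIntegral_const]
    exact (setLIntegral_mono' measurableSet_closedBall hlow).trans
      (lintegral_closedBall_measure_le _ _ _)
  rw [Measure.addHaar_closedBall _ _ hρ.le, Measure.addHaar_closedBall _ _ hr.le, ← mul_assoc,
    ENNReal.mul_le_mul_iff_left (measure_ball_pos _ _ one_pos).ne' measure_ball_lt_top.ne,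
    ← ENNReal.ofReal_mul (by positivity), ENNReal.ofReal_le_ofReal_iff (by positivity),
    finrank_euclideanSpace_fin] at h1
  rw [div_pow, ← mul_div_assoc, div_le_iff₀ (by positivity)]
  rwa [div_mul_eq_mul_div, div_le_iff₀ hK, mul_comm _ K] at h1

open Metric in
/-- Nine equally spaced points of the ball of radius `ρ > 8 r` on a line. -/
theorem exists_nine_points (hd : 1 ≤ d) (hr : 0 < r) (hρ : 8 * r < ρ) :
    ∃ x : Fin 9 → EuclideanSpace ℝ (Fin d), (∀ k, ‖x k‖ ≤ ρ) ∧
      Pairwise fun i j => Disjoint (closedBall (x i) r) (closedBall (x j) r) := by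
  have hρ0 : 0 < ρ := by linarith
  let e : EuclideanSpace ℝ (Fin d) := EuclideanSpace.single ⟨0, hd⟩ 1
  have he : ‖e‖ = 1 := by simp [e]
  -- The multiples run from -4 to 4, and the spacing `ρ / 4` exceeds `2 r`.
  refine ⟨fun k => (((k : ℝ) - 4) * (ρ / 4)) • e, fun k => ?_, fun i j hij => ?_⟩
  · have hk : (k : ℝ) ≤ 8 := by exact_mod_cast Nat.lt_succ_iff.mp k.2
    have hk0 : (0 : ℝ) ≤ k := by positivity
    rw [norm_smul, he, mul_one, Real.norm_eq_abs, abs_le]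
    constructor <;> nlinarith
  · refine closedBall_disjoint_closedBall ?_
    rw [dist_eq_norm, ← sub_smul, norm_smul, he, mul_one, Real.norm_eq_abs, ← sub_mul, abs_mul,
      abs_of_pos (by positivity : 0 < ρ / 4)]
    have h1 : (1 : ℝ) ≤ |(i : ℝ) - 4 - ((j : ℝ) - 4)| := by
      have h2 : (i : ℤ) - (j : ℤ) ≠ 0 := fun h =>
        hij (Fin.ext (by exact_mod_cast sub_eq_zero.mp h))
      have h3 := Int.one_le_abs h2
      rw [sub_sub_sub_cancel_right]
      exact_mod_cast h3
    nlinarith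

-- The nine disjoint balls share total mass at most 1 under `P 0`. As success is only guaranteed
-- probability 1/8, eight balls would give nothing even for `a = 1`; the ninth leaves room for `a`
-- slightly above 1.
open Metric in
theorem nine_mul_rpow_le (hd : 1 ≤ d) (hr : 0 < r) (hρ : 8 * r < ρ) (ha : 0 ≤ a) (hK : 0 < K)
    (hb : b ≤ 7 / 8)
    (hP : ∀ μ μ' S, ‖μ‖ ≤ ρ → ‖μ'‖ ≤ ρ → MeasurableSet S →
      (P μ).real S ^ a ≤ K * (P μ').real S)
    (hacc : ∀ μ, ‖μ‖ ≤ ρ → 1 - b ≤ (P μ).real (closedBall μ r)) :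
    9 * (1 / 8 : ℝ) ^ a ≤ K := by
  obtain ⟨x, hx, hdis⟩ := exists_nine_points hd hr hρ
  have h1 : ∀ k, (1 / 8 : ℝ) ^ a ≤ K * (P 0).real (closedBall (x k) r) := fun k => by
    refine le_trans ?_ (hP (x k) 0 _ (hx k) (by simp; linarith) measurableSet_closedBall)
    gcongr
    linarith [hacc _ (hx k)]
  have h2 : ∑ k, (P 0).real (closedBall (x k) r) ≤ 1 := by
    rw [← measureReal_iUnion_fintype hdis fun _ => measurableSet_closedBall]
    exact measureReal_le_one
  have h3 := Finset.sum_le_sum fun k (_ : k ∈ Finset.univ) => h1 k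
  rw [← Finset.mul_sum] at h3
  simp only [Finset.sum_const, Finset.card_univ, Fintype.card_fin, nsmul_eq_mul] at h3
  push_cast at h3
  nlinarith

-- If the mean is `x 1`, landing near `x 0` is a failure, so it has probability at most `b`;
-- comparability with the law for `x 0` bounds it from below.
open Metric in
theorem rpow_le_mul_of_accurate (hd : 1 ≤ d) (hr : 0 < r) (hρ : 8 * r < ρ) (ha : 0 ≤ a)
    (hK : 0 < K) (hb : b ≤ 7 / 8)
    (hP : ∀ μ μ' S, ‖μ‖ ≤ ρ → ‖μ'‖ ≤ ρ → MeasurableSet S →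
      (P μ).real S ^ a ≤ K * (P μ').real S)
    (hacc : ∀ μ, ‖μ‖ ≤ ρ → 1 - b ≤ (P μ).real (closedBall μ r)) :
    (1 / 8 : ℝ) ^ a ≤ K * b := by
  obtain ⟨x, hx, hdis⟩ := exists_nine_points hd hr hρ
  have h1 : (1 / 8 : ℝ) ^ a ≤ K * (P (x 1)).real (closedBall (x 0) r) := by
    refine le_trans ?_ (hP (x 0) (x 1) _ (hx 0) (hx 1) measurableSet_closedBall)
    gcongr
    linarith [hacc _ (hx 0)]
  have h2 : (P (x 1)).real (closedBall (x 0) r) + (P (x 1)).real (closedBall (x 1) r) ≤ 1 := by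
    rw [← measureReal_union (hdis zero_ne_one) measurableSet_closedBall]
    exact measureReal_le_one
  refine h1.trans ?_
  gcongr
  linarith [hacc _ (hx 1)]

/-- The exponent `20/19` is close enough to 1 because `8^20 < 9^19`; hence `nine_mul_rpow_le` bounds
`K` away from 1. -/
theorem log_nine_sub_pos : 0 < Real.log 9 - 20 / 19 * Real.log 8 := by
  have h : Real.log ((8 : ℝ) ^ 20) < Real.log ((9 : ℝ) ^ 19) :=
    Real.log_lt_log (by positivity) (by norm_num)
  rw [Real.log_pow, Real.log_pow] at h
  push_cast at h
  linarith

/-- The constant in `mul_log_add_log_le_log`. -/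
noncomputable def packingConstant : ℝ :=
  (2 * (1 + 20 / 19 * Real.log 8 / (Real.log 9 - 20 / 19 * Real.log 8)))⁻¹

theorem packingConstant_pos : 0 < packingConstant := by
  have := log_nine_sub_pos
  unfold packingConstant
  positivity

open Metric in
/-- A family of laws which are comparable up to a factor `K`, and each of which is likely to give
an accurate estimate of its parameter, exists only if `K` is large. -/
theorem mul_log_add_log_le_log (hd : 1 ≤ d) (hr : 0 < r) (hρ : 8 * r < ρ) (hK : 0 < K)
    (hb0 : 0 < b) (hb : b ≤ 7 / 8)
    (hP : ∀ μ μ' S, ‖μ‖ ≤ ρ → ‖μ'‖ ≤ ρ → MeasurableSet S →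
      (P μ).real S ^ (20 / 19 : ℝ) ≤ K * (P μ').real S)
    (hacc : ∀ μ, ‖μ‖ ≤ ρ → 1 - b ≤ (P μ).real (closedBall μ r)) :
    packingConstant * (d * Real.log (ρ / r) + Real.log (1 / b)) ≤ Real.log K := by
  have hρ0 : 0 < ρ := by linarith
  have hlog8 : Real.log ((1 / 8 : ℝ) ^ (20 / 19 : ℝ)) = -(20 / 19 * Real.log 8) := by
    rw [Real.log_rpow (by norm_num), one_div, Real.log_inv]
    ring
  have h8 : (0 : ℝ) < (1 / 8 : ℝ) ^ (20 / 19 : ℝ) := by positivity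
  have h1 := Real.log_le_log (by positivity)
    (rpow_mul_div_pow_le hr hρ0 (by norm_num) hK hb hP hacc)
  have h2 := Real.log_le_log (by positivity)
    (nine_mul_rpow_le hd hr hρ (by norm_num) hK hb hP hacc)
  have h3 := Real.log_le_log h8 (rpow_le_mul_of_accurate hd hr hρ (by norm_num) hK hb hP hacc)
  rw [Real.log_mul h8.ne' (by positivity), Real.log_pow, hlog8] at h1
  rw [Real.log_mul (by norm_num) h8.ne', hlog8] at h2
  rw [Real.log_mul hK.ne' hb0.ne', hlog8] at h3
  have hc := log_nine_sub_pos
  set t := 20 / 19 * Real.log 8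
  have ht : 0 ≤ t := by positivity
  -- The nine-ball bound `log 9 - t ≤ log K` turns the additive loss `t` in `h1` and `h3` into a
  -- multiple of `log K`.
  have h4 : t ≤ t / (Real.log 9 - t) * Real.log K := by
    rw [div_mul_eq_mul_div, le_div_iff₀ hc]
    gcongr
    linarith
  have hfac : packingConstant = (2 * (1 + t / (Real.log 9 - t)))⁻¹ := rfl
  rw [hfac, inv_mul_le_iff₀ (by positivity), one_div, Real.log_inv]
  linarith

end Packing

/-! ### Gaussians with scalar covariance -/

section Isotropic

variable {d : ℕ} {σ : ℝ}

theorem sqrt_smul_one (hσ : 0 ≤ σ) :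
    CFC.sqrt (σ ^ 2 • (1 : Matrix (Fin d) (Fin d) ℝ)) = σ • 1 := by
  refine CFC.sqrt_unique ?_ ?_
  · rw [smul_mul_smul_comm, one_mul, sq]
  · rw [Matrix.nonneg_iff_posSemidef]
    exact Matrix.PosSemidef.one.smul hσ

theorem multivariateGaussian_smul_one (hσ : 0 ≤ σ) (μ : EuclideanSpace ℝ (Fin d)) :
    multivariateGaussian μ (σ ^ 2 • (1 : Matrix (Fin d) (Fin d) ℝ)) =
      (stdGaussian (EuclideanSpace ℝ (Fin d))).map fun x => μ + σ • x := by
  rw [multivariateGaussian, sqrt_smul_one hσ]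
  simp

theorem mahalanobisNorm_smul_one (hσ : 0 < σ) (v : EuclideanSpace ℝ (Fin d)) :
    mahalanobisNorm (σ ^ 2 • (1 : Matrix (Fin d) (Fin d) ℝ)) v = ‖v‖ / σ := by
  have hinv : (σ • (1 : Matrix (Fin d) (Fin d) ℝ))⁻¹ = σ⁻¹ • 1 := by
    refine Matrix.inv_eq_left_inv ?_
    rw [smul_mul_smul_comm, one_mul, inv_mul_cancel₀ hσ.ne', one_smul]
  rw [mahalanobisNorm, sqrt_smul_one hσ.le, hinv]
  simp [norm_smul, abs_of_pos hσ, div_eq_inv_mul]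

/-- The law of one sample with mean `μ` and covariance `σ ^ 2 I`. -/
noncomputable def isotropicGaussian (σ : ℝ) (μ : EuclideanSpace ℝ (Fin d)) :
    Measure (EuclideanSpace ℝ (Fin d)) :=
  (stdGaussian (EuclideanSpace ℝ (Fin d))).map fun x => μ + σ • x

instance (μ : EuclideanSpace ℝ (Fin d)) : IsProbabilityMeasure (isotropicGaussian σ μ) :=
  Measure.isProbabilityMeasure_map (Measurable.aemeasurable (by fun_prop))

theorem lintegral_isotropicGaussian (μ : EuclideanSpace ℝ (Fin d))
    {g : EuclideanSpace ℝ (Fin d) → ℝ≥0∞} (hg : Measurable g) :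
    ∫⁻ x, g x ∂isotropicGaussian σ μ =
      ∫⁻ x, g (μ + σ • x) ∂stdGaussian (EuclideanSpace ℝ (Fin d)) :=
  lintegral_map hg (by fun_prop)

theorem lintegral_isotropicGaussian_eq_add (hσ : 0 < σ) (μ μ' : EuclideanSpace ℝ (Fin d))
    {g : EuclideanSpace ℝ (Fin d) → ℝ≥0∞} (hg : Measurable g) :
    ∫⁻ x, g x ∂isotropicGaussian σ μ =
      ∫⁻ x, g (μ' + σ • (x + σ⁻¹ • (μ - μ'))) ∂stdGaussian (EuclideanSpace ℝ (Fin d)) := by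
  rw [lintegral_isotropicGaussian μ hg]
  refine lintegral_congr fun x => ?_
  rw [smul_add, smul_inv_smul₀ hσ.ne']
  congr 1
  abel

theorem rpow_lintegral_isotropicGaussian_le (hσ : 0 < σ) (μ μ' : EuclideanSpace ℝ (Fin d))
    {p q : ℝ} (hpq : p.HolderConjugate q)
    {g : EuclideanSpace ℝ (Fin d) → ℝ≥0∞} (hg : Measurable g) :
    (∫⁻ x, g x ∂isotropicGaussian σ μ) ^ q ≤
      ENNReal.ofReal (Real.exp (p * (‖μ - μ'‖ / σ) ^ 2 / 2)) *
        ∫⁻ x, g x ^ q ∂isotropicGaussian σ μ' := by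
  rw [lintegral_isotropicGaussian_eq_add hσ μ μ' hg,
    lintegral_isotropicGaussian μ' (hg.pow_const q)]
  have h := rpow_lintegral_add_stdGaussian_le (σ⁻¹ • (μ - μ')) hpq
    (g := fun x => g (μ' + σ • x)) (by fun_prop)
  rwa [norm_smul, norm_inv, Real.norm_of_nonneg hσ.le, ← div_eq_inv_mul] at h

theorem lintegral_isotropicGaussian_le (hσ : 0 < σ) (μ μ' : EuclideanSpace ℝ (Fin d)) {ε : ℝ}
    (hε0 : 0 ≤ ε) (hε : ε ≤ 1) {g : EuclideanSpace ℝ (Fin d) → ℝ≥0∞} (hg : Measurable g)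
    (hg1 : ∀ x, g x ≤ 1) (hgε : ∀ x y, g x ≤ ENNReal.ofReal (Real.exp ε) * g y) :
    ∫⁻ x, g x ∂isotropicGaussian σ μ ≤
      ENNReal.ofReal (Real.exp (5 * ε * (‖μ - μ'‖ / σ))) *
        ∫⁻ x, g x ∂isotropicGaussian σ μ' := by
  rw [lintegral_isotropicGaussian_eq_add hσ μ μ' hg, lintegral_isotropicGaussian μ' hg]
  have h := lintegral_add_stdGaussian_le (σ⁻¹ • (μ - μ')) hε0 hε
    (g := fun x => g (μ' + σ • x)) (by fun_prop) (fun _ => hg1 _) (fun _ _ => hgε _ _)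
  rwa [norm_smul, norm_inv, Real.norm_of_nonneg hσ.le, ← div_eq_inv_mul] at h

end Isotropic

/-! ### Comparison of output laws -/

section OutputLaw

variable {n : ℕ} {α β : Type*} [MeasurableSpace α] [MeasurableSpace β]
  {M : Kernel (Fin n → α) β}

theorem outputLaw_apply (P : Measure α) {S : Set β} (hS : MeasurableSet S) :
    outputLaw M P S = ∫⁻ X, M X S ∂Measure.pi (fun _ : Fin n => P) :=
  Measure.bind_apply hS M.measurable.aemeasurable

variable [IsMarkovKernel M]

instance (P : Measure α) [IsProbabilityMeasure P] : IsProbabilityMeasure (outputLaw M P) := by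
  constructor
  rw [outputLaw_apply P MeasurableSet.univ]
  simp

/-- A comparison of the means under `P` and `Q` of functions which vary by a factor of at most
`e ^ ε` gives a comparison of the output laws of a differentially private mechanism. -/
theorem IsPureDP.outputLaw_le {ε : ℝ} (hM : IsPureDP M ε) (hε : 0 ≤ ε) (P Q : Measure α)
    [IsProbabilityMeasure P] [IsProbabilityMeasure Q] {k : ℝ}
    (hPQ : ∀ g : α → ℝ≥0∞, Measurable g → (∀ x, g x ≤ 1) →
      (∀ x y, g x ≤ ENNReal.ofReal (Real.exp ε) * g y) →
      ∫⁻ x, g x ∂P ≤ ENNReal.ofReal (Real.exp k) * ∫⁻ x, g x ∂Q)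
    {S : Set β} (hS : MeasurableSet S) :
    (outputLaw M P).real S ≤ Real.exp (n * k) * (outputLaw M Q).real S := by
  have h := lintegral_pi_le_of_hammingDist P Q
    (ENNReal.one_le_ofReal.mpr (Real.one_le_exp hε)) hPQ (M.measurable_coe hS)
    (fun _ => prob_le_one) fun X Y hXY => hM X Y hXY S hS
  rw [← outputLaw_apply P hS, ← outputLaw_apply Q hS, ← ENNReal.ofReal_pow (Real.exp_pos _).le,
    ← Real.exp_nat_mul] at h
  have h2 := ENNReal.toReal_mono
    (ENNReal.mul_ne_top ENNReal.ofReal_ne_top (measure_ne_top _ _)) h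
  rwa [ENNReal.toReal_mul, ENNReal.toReal_ofReal (Real.exp_pos _).le] at h2

theorem rpow_outputLaw_le (P Q : Measure α) [IsProbabilityMeasure P] [IsProbabilityMeasure Q]
    {q k : ℝ} (hq : 1 ≤ q)
    (hPQ : ∀ g : α → ℝ≥0∞, Measurable g →
      (∫⁻ x, g x ∂P) ^ q ≤ ENNReal.ofReal (Real.exp k) * ∫⁻ x, g x ^ q ∂Q)
    {S : Set β} (hS : MeasurableSet S) :
    (outputLaw M P).real S ^ q ≤ Real.exp (n * k) * (outputLaw M Q).real S := by
  have h : outputLaw M P S ^ q ≤ ENNReal.ofReal (Real.exp (n * k)) * outputLaw M Q S := by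
    rw [outputLaw_apply P hS, outputLaw_apply Q hS, Real.exp_nat_mul,
      ENNReal.ofReal_pow (Real.exp_pos _).le]
    refine (rpow_lintegral_pi_le P Q hPQ (M.measurable_coe hS)).trans ?_
    gcongr with X
    -- The integrand is a probability, so its power `q ≥ 1` may be dropped.
    exact (ENNReal.rpow_le_rpow_of_exponent_ge prob_le_one hq).trans_eq (ENNReal.rpow_one _)
  have h2 := ENNReal.toReal_mono
    (ENNReal.mul_ne_top ENNReal.ofReal_ne_top (measure_ne_top _ _)) h
  rwa [ENNReal.toReal_mul, ENNReal.toReal_ofReal (Real.exp_pos _).le, ← ENNReal.toReal_rpow] at h2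

theorem lintegral_le_of_forall_le_mul (P Q : Measure α) [IsProbabilityMeasure P]
    [IsProbabilityMeasure Q] {c : ℝ≥0∞} {g : α → ℝ≥0∞} (hg : Measurable g)
    (hgc : ∀ x y, g x ≤ c * g y) :
    ∫⁻ x, g x ∂P ≤ c * ∫⁻ x, g x ∂Q := by
  have h : ∀ x, g x ≤ c * ∫⁻ y, g y ∂Q := fun x => by
    rw [← lintegral_const_mul _ hg]
    simpa using lintegral_mono (μ := Q) (f := fun _ => g x) (hgc x)
  exact (lintegral_mono h).trans (by simp)

end OutputLaw

/-! ### The three lower bounds -/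

section LowerBounds

variable {d n : ℕ} {R L α ε β : ℝ}
  {M : Kernel (Fin n → EuclideanSpace ℝ (Fin d)) (EuclideanSpace ℝ (Fin d))} [IsMarkovKernel M]

open Metric in
theorem EstimatesGaussianMean.one_sub_le_real_closedBall (hM : EstimatesGaussianMean M R L α β)
    (hL : 0 < L) {μ : EuclideanSpace ℝ (Fin d)} (hμ : ‖μ‖ ≤ R) :
    1 - β ≤ (outputLaw M (isotropicGaussian (√L)⁻¹ μ)).real (closedBall μ (α / √L)) := by
  have hσ : 0 < (√L)⁻¹ := by positivity
  have hL1 : 1 / L = (√L)⁻¹ ^ 2 := by rw [inv_pow, Real.sq_sqrt hL.le, one_div]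
  have h := hM μ ((1 / L) • 1) hμ (by rw [sub_self]; exact Matrix.PosSemidef.zero)
  have hset : {μ' | mahalanobisNorm ((1 / L) • (1 : Matrix (Fin d) (Fin d) ℝ)) (μ - μ') ≤ α} =
      closedBall μ (α / √L) := by
    ext μ'
    rw [Set.mem_ofPred_eq, hL1, mahalanobisNorm_smul_one hσ, mem_closedBall, dist_comm,
      dist_eq_norm, div_le_iff₀ hσ, ← div_eq_mul_inv]
  rw [hset, hL1, multivariateGaussian_smul_one hσ.le] at h
  exact (ENNReal.ofReal_le_iff_le_toReal (measure_ne_top _ _)).mp h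

/-- Puts the linear comparisons coming from privacy in the power form that the packing bound takes.
-/
theorem rpow_real_le_of_le {Ω : Type*} [MeasurableSpace Ω] (P : Measure Ω) [IsProbabilityMeasure P]
    {q x : ℝ} (hq : 1 ≤ q) {S : Set Ω} (h : P.real S ≤ x) : P.real S ^ q ≤ x :=
  ((Real.rpow_le_rpow_of_exponent_ge' measureReal_nonneg measureReal_le_one zero_le_one hq).trans_eq
    (Real.rpow_one _)).trans h

theorem privacy_lower_bound (hd : 1 ≤ d) (hα : 0 < α) (hL : 1 ≤ L) (hR : 8 * α / √L < R)
    (hε : 0 < ε) (hβ0 : 0 < β) (hβ : β ≤ 7 / 8) (hDP : IsPureDP M ε)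
    (hM : EstimatesGaussianMean M R L α β) :
    packingConstant * (d * Real.log (R * √L / α) + Real.log (1 / β)) ≤ n * ε := by
  have hL0 : 0 < L := by linarith
  have h := mul_log_add_log_le_log (P := fun μ => outputLaw M (isotropicGaussian (√L)⁻¹ μ))
    (ρ := R) (r := α / √L) (K := Real.exp (n * ε)) hd (by positivity)
    (by rwa [← mul_div_assoc]) (Real.exp_pos _) hβ0 hβ
    (fun μ μ' S _ _ hS => rpow_real_le_of_le _ (by norm_num) (hDP.outputLaw_le hε.le _ _
      (fun g hg _ hgε => lintegral_le_of_forall_le_mul _ _ hg hgε) hS))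
    fun μ hμ => hM.one_sub_le_real_closedBall hL0 hμ
  rwa [Real.log_exp, div_div_eq_mul_div] at h

/-- The lower bound in terms of the comparability of the output laws for means at distance at most
`18 α / √L`. -/
theorem local_lower_bound (hd : 1 ≤ d) (hα : 0 < α) (hL : 1 ≤ L) (hR : 8 * α / √L < R)
    (hβ0 : 0 < β) (hβ : β ≤ 7 / 8) (hM : EstimatesGaussianMean M R L α β) {k : ℝ}
    (hk : ∀ (μ μ' : EuclideanSpace ℝ (Fin d)) (S : Set (EuclideanSpace ℝ (Fin d))),
      ‖μ - μ'‖ / (√L)⁻¹ ≤ 18 * α → MeasurableSet S →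
      (outputLaw M (isotropicGaussian (√L)⁻¹ μ)).real S ^ (20 / 19 : ℝ) ≤
        Real.exp k * (outputLaw M (isotropicGaussian (√L)⁻¹ μ')).real S) :
    packingConstant * (d + Real.log (1 / β)) ≤ k := by
  have hL0 : 0 < L := by linarith
  have hr : 0 < α / √L := by positivity
  -- The radius is just large enough for nine disjoint balls, stays within `R`, and keeps means
  -- within `18 α / √L` of each other.
  have hρ : 8 * (α / √L) < min R (9 * (α / √L)) :=
    lt_min (by rwa [← mul_div_assoc]) (by linarith)
  have h := mul_log_add_log_le_log (P := fun μ => outputLaw M (isotropicGaussian (√L)⁻¹ μ))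
    (K := Real.exp k) hd hr hρ (Real.exp_pos _) hβ0 hβ
    (fun μ μ' S hμ hμ' hS => hk μ μ' S (by
      have h1 := hμ.trans (min_le_right _ _)
      have h2 := hμ'.trans (min_le_right _ _)
      rw [div_inv_eq_mul, ← le_div_iff₀ (by positivity), mul_div_assoc]
      linarith [norm_sub_le μ μ']) hS)
    fun μ hμ => hM.one_sub_le_real_closedBall hL0 (hμ.trans (min_le_left _ _))
  rw [Real.log_exp] at h
  refine le_trans ?_ h
  have hlog : 1 ≤ Real.log (min R (9 * (α / √L)) / (α / √L)) := by
    rw [Real.le_log_iff_exp_le (div_pos (by linarith) hr), le_div_iff₀ hr]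
    nlinarith [Real.exp_one_lt_three]
  have hd0 : (0 : ℝ) ≤ d := by positivity
  have := packingConstant_pos
  gcongr
  exact le_mul_of_one_le_right hd0 hlog

theorem private_local_lower_bound (hd : 1 ≤ d) (hα : 0 < α) (hL : 1 ≤ L) (hR : 8 * α / √L < R)
    (hε : 0 < ε) (hε1 : ε < 1) (hβ0 : 0 < β) (hβ : β ≤ 7 / 8) (hDP : IsPureDP M ε)
    (hM : EstimatesGaussianMean M R L α β) :
    packingConstant * (d + Real.log (1 / β)) ≤ n * (90 * (α * ε)) := by
  have hL0 : 0 < L := by linarith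
  refine local_lower_bound hd hα hL hR hβ0 hβ hM fun μ μ' S hμ hS =>
    rpow_real_le_of_le _ (by norm_num) (hDP.outputLaw_le hε.le _ _ (fun g hg hg1 hgε =>
      (lintegral_isotropicGaussian_le (by positivity) μ μ' hε.le hε1.le hg hg1 hgε).trans ?_) hS)
  -- `90 = 5 * 18`.
  exact mul_le_mul' (ENNReal.ofReal_le_ofReal (Real.exp_le_exp.mpr (by nlinarith))) le_rfl

theorem statistical_lower_bound (hd : 1 ≤ d) (hα : 0 < α) (hL : 1 ≤ L) (hR : 8 * α / √L < R)
    (hβ0 : 0 < β) (hβ : β ≤ 7 / 8) (hM : EstimatesGaussianMean M R L α β) :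
    packingConstant * (d + Real.log (1 / β)) ≤ n * (3240 * α ^ 2) := by
  have hL0 : 0 < L := by linarith
  have hpq : (20 : ℝ).HolderConjugate (20 / 19) :=
    (Real.holderConjugate_iff).mpr (by norm_num)
  refine local_lower_bound hd hα hL hR hβ0 hβ hM fun μ μ' S hμ hS =>
    rpow_outputLaw_le _ _ (by norm_num) (fun g hg =>
      (rpow_lintegral_isotropicGaussian_le (by positivity) μ μ' hpq hg).trans ?_) hS
  -- With `p = 20` the exponent is at most `20 * (18 α)^2 / 2 = 3240 α^2`.
  have h := pow_le_pow_left₀ (by positivity) hμ 2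
  gcongr
  nlinarith

end LowerBounds

theorem mainTheorem10 :
    ∃ c : ℝ, 0 < c ∧
      ∀ (d n : ℕ) (R L α ε β : ℝ),
        1 ≤ d → 0 < α → 1 ≤ L → 8 * α / Real.sqrt L < R →
        0 < ε → ε < 1 → 0 < β → β ≤ 7 / 8 →
        ∀ (M : Kernel (Fin n → EuclideanSpace ℝ (Fin d)) (EuclideanSpace ℝ (Fin d)))
          [IsMarkovKernel M],
          IsPureDP M ε → EstimatesGaussianMean M R L α β →
          c * ((d + Real.log (1 / β)) / α ^ 2
              + (d + Real.log (1 / β)) / (α * ε)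
              + (d * Real.log (R * Real.sqrt L / α) + Real.log (1 / β)) / ε) ≤ (n : ℝ) := by
  have hc := packingConstant_pos
  -- `9720 = 3 * 3240` covers the sum `3240 + 90 + 1` of the three constants.
  refine ⟨packingConstant / 9720, by positivity, ?_⟩
  intro d n R L α ε β hd hα hL hR hε hε1 hβ0 hβ M _ hDP hM
  have h1 : packingConstant * ((d + Real.log (1 / β)) / α ^ 2) ≤ n * 3240 := by
    rw [← mul_div_assoc, div_le_iff₀ (by positivity), mul_assoc]
    exact statistical_lower_bound hd hα hL hR hβ0 hβ hM
  have h2 : packingConstant * ((d + Real.log (1 / β)) / (α * ε)) ≤ n * 90 := by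
    rw [← mul_div_assoc, div_le_iff₀ (by positivity), mul_assoc]
    exact private_local_lower_bound hd hα hL hR hε hε1 hβ0 hβ hDP hM
  have h3 : packingConstant *
      ((d * Real.log (R * Real.sqrt L / α) + Real.log (1 / β)) / ε) ≤ n := by
    rw [← mul_div_assoc, div_le_iff₀ hε]
    exact privacy_lower_bound hd hα hL hR hε hβ0 hβ hDP hM
  have hn : (0 : ℝ) ≤ n := n.cast_nonneg
  rw [div_mul_eq_mul_div, div_le_iff₀ (by norm_num), mul_add, mul_add]
  linarith
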